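/- **Setting.** Let $d\ge 0$, $m\ge 1$ be integers, $\theta\in(0,\pi/2)$, $r>0$, $c>0$, and put $C(\theta)=\dfrac{16(1+\sin\theta)^2m^2}{3\sin^2\theta}$. Let $\varphi:[0,\infty)\to[0,\infty)$ be a bounded weight profile with $\varphi(s)=0$ for $s>1$ and $\inf_{[0,\rho]}\varphi>0$ for every $0\le\rho<\tfrac12$. (For continuous $\varphi\ge 0$ vanishing on $(1,\infty)$ this just says that $\varphi>0$ on $[0,\tfrac12)$.) Let $\alpha\in\mathbb N_0^d$ be a multi-index with $|\alpha|\le m+1$. Let $\Omega\subset\mathbb R^d$ be a compact set which satisfies the interior cone condition with angle $\theta$ and radius $r$: for every $x\in\Omega$ there is a unit vector $\xi$ with $\{x+ty:\ \|y\|=1,\ y\cdot\xi\ge\cos\theta,\ 0\le t\le r\}\subset\Omega$. Let $\Omega_h\subset\mathbb R^d$ be a finite point cloud (not necessarily contained in $\Omega$), $x_i\in\Omega_h\cap\Omega$, $\varepsilon>0$, and let $$M_i=\Big\{x_{ij}=\tfrac{x_i+x_j}{2}\ :\ x_j\in\Omega_h,\ x_j\ne x_i,\ \|x_j-x_i\|<\varepsilon\Big\}$$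 be the set of edge midpoints. Assume that $M_i$ is nonempty and contained in $\Omega$, and let $$h=\sup_{x\in\Omega}\min_{y\in M_i}\|x-y\|,\qquad q=\tfrac12\min_{y\neq z\in M_i}\|y-z\|$$ be its fill distance in $\Omega$ and its separation distance ($q:=0$ if $M_i$ is a single point). Assume that $M_i$ is quasi-uniform, $q\le h\le c\,q$, and that $h\le r/C(\theta)$. Put $$\delta=2C(\theta)h,\qquad \Phi(s)=\varphi(s/\delta),\qquad \Omega^*=\overline{B(x_i,\delta)}.$$ Let $P_m^i$ be the space of real polynomials on $\mathbb R^d$ of degree at most $m$ that vanish at $x_i$. For a function $u$ consider the weighted least-squares problem $$p^*=\operatorname*{arg\,min}_{p\in P_m^i}\ \tfrac12\sum_{x_{ij}\in M_i}\big(u(x_{ij})-p(x_{ij})\big)^2\,\Phi(\|x_i-x_{ij}\|).$$ The specialized GMLS derivative of $u$ at $x_i$ is $\widetilde D^\alpha u(x_i):=D^\alpha p^*(x_i)$; equivalently, if $p^*=\sum_k b_kp_k$ in a basis $(p_k)$ of $P_m^i$, it is $\sum_k b_k D^\alpha p_k(x_i)$. **Lemma.** There is a constant $C>0$, depending only on $d,m,\theta,r,c,\varphi,\alpha$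 (and not on $\Omega$, $\Omega_h$, $x_i$, $\varepsilon$, $h$ or $u$), such that in the above setting, for every $u:\mathbb R^d\to\mathbb R$ that is $C^{m+1}$ on $\Omega^*$ and satisfies $u(x_i)=0$, the least-squares problem has exactly one solution $p^*$, and $$\big|\widetilde D^\alpha u(x_i)-D^\alpha u(x_i)\big|\ \le\ C\,h^{\,m+1-|\alpha|}\,\|u\|_{C^{m+1}(\Omega^*)},\qquad \|u\|_{C^{m+1}(\Omega^*)}=\max_{|\beta|\le m+1}\ \sup_{x\in\Omega^*}|D^\beta u(x)|.$$ -/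

import Mathlib

namespace GMLS

/-- Points of `ℝ^d` with the Euclidean norm. -/
abbrev Pt (d : ℕ) : Type := EuclideanSpace ℝ (Fin d)

/-! ### Partial derivatives and the norm of `C^k` -/

/-- The directions of differentiation in `D^α`: the index `i` is listed `α i` times. This list
has length `|α| = ∑ i, α i`. -/
def dirs {d : ℕ} (α : Fin d → ℕ) : List (Fin d) :=
  (List.finRange d).flatMap fun i => List.replicate (α i) i

/-- The partial derivative `D^α f (x)` of a function on `ℝ^d`. -/
noncomputable def partialD {d : ℕ} (α : Fin d → ℕ) (f : Pt d → ℝ) (x : Pt d) : ℝ :=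
  iteratedFDeriv ℝ (dirs α).length f x
    fun k => EuclideanSpace.single ((dirs α).get k) (1 : ℝ)

/-- The partial derivative `D^α f (x)` of a function on a set `S ⊆ ℝ^d`, up to the boundary. -/
noncomputable def partialDWithin {d : ℕ} (α : Fin d → ℕ) (f : Pt d → ℝ) (S : Set (Pt d))
    (x : Pt d) : ℝ :=
  iteratedFDerivWithin ℝ (dirs α).length f S x
    fun k => EuclideanSpace.single ((dirs α).get k) (1 : ℝ)

/-- `‖f‖_{C^k(S)} = max_{|β| ≤ k} sup_{x ∈ S} |D^β f (x)|`. For compact `S` with unique derivatives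
(such as a closed ball) and `f ∈ C^k(S)` the supremum is over a bounded set. -/
noncomputable def cNorm {d : ℕ} (k : ℕ) (S : Set (Pt d)) (f : Pt d → ℝ) : ℝ :=
  ⨆ z : {β : Fin d → ℕ // ∑ i, β i ≤ k} × S, |partialDWithin z.1.1 f S z.2|

/-! ### Regions and point sets -/

/-- The cone with apex `x`, axis `ξ`, angle `θ` and radius `r`. -/
def cone {d : ℕ} (x ξ : Pt d) (θ r : ℝ) : Set (Pt d) :=
  {z | ∃ (t : ℝ) (y : Pt d), 0 ≤ t ∧ t ≤ r ∧ ‖y‖ = 1 ∧ Real.cos θ ≤ inner ℝ y ξ ∧ z = x + t • y}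

/-- Interior cone condition with radius `r` and angle `θ`. -/
def InteriorConeCondition {d : ℕ} (Ω : Set (Pt d)) (θ r : ℝ) : Prop :=
  ∀ x ∈ Ω, ∃ ξ : Pt d, ‖ξ‖ = 1 ∧ cone x ξ θ r ⊆ Ω

/-- The fill distance `h_{X,Ω} = sup_{x ∈ Ω} min_{y ∈ X} ‖x - y‖` (for nonempty `X` and
bounded `Ω`). -/
noncomputable def fillDist {d : ℕ} (X : Finset (Pt d)) (Ω : Set (Pt d)) : ℝ :=
  sSup ((fun x => Metric.infDist x (X : Set (Pt d))) '' Ω)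

/-- The separation distance `q_X = (1/2) min_{x ≠ y ∈ X} ‖x - y‖` (for `X` with at least two
points). -/
noncomputable def sepDist {d : ℕ} (X : Finset (Pt d)) : ℝ :=
  (1 / 2) * sInf {s : ℝ | ∃ x ∈ X, ∃ y ∈ X, x ≠ y ∧ s = ‖x - y‖}

/-- `X` is quasi-uniform in `Ω` with constant `c`. -/
def QuasiUniform {d : ℕ} (c : ℝ) (X : Finset (Pt d)) (Ω : Set (Pt d)) : Prop :=
  sepDist X ≤ fillDist X Ω ∧ fillDist X Ω ≤ c * sepDist X

/-- `C(θ) = 16 (1 + sin θ)² m² / (3 sin² θ)`. -/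
noncomputable def coneConst (m : ℕ) (θ : ℝ) : ℝ :=
  16 * (1 + Real.sin θ) ^ 2 * (m : ℝ) ^ 2 / (3 * Real.sin θ ^ 2)

open Classical in
/-- The midpoints `(x + y) / 2` of the edges joining `x` to the other points `y` of its
`ε`-neighborhood in the point cloud `Ωh`. -/
noncomputable def midpoints {d : ℕ} (Ωh : Finset (Pt d)) (x : Pt d) (ε : ℝ) : Finset (Pt d) :=
  (Ωh.filter fun y => y ≠ x ∧ ‖y - x‖ < ε).image fun y => midpoint ℝ x y

/-! ### Weights -/

/-- Profile `φ` of the radial weights `Φ(s) = φ(s / δ)`: it is nonnegative, vanishes for `s > 1`,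
is bounded, and on `[0, 1/2)` it is positive, locally bounded away from `0` (for a continuous `φ`
that vanishes for `s > 1`, the last two conditions say exactly that `φ > 0` on `[0, 1/2)`). -/
structure IsWeightProfile (φ : ℝ → ℝ) : Prop where
  nonneg : ∀ s, 0 ≤ s → 0 ≤ φ s
  support : ∀ s, 1 < s → φ s = 0
  bounded : ∃ K, ∀ s, 0 ≤ s → φ s ≤ K
  pos : ∀ ρ, ρ < 1 / 2 → ∃ κ, 0 < κ ∧ ∀ s, 0 ≤ s → s ≤ ρ → κ ≤ φ s

/-! ### The specialized GMLS derivative -/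

/-- The function on `ℝ^d` given by a polynomial. -/
noncomputable def polyFun {d : ℕ} (p : MvPolynomial (Fin d) ℝ) (x : Pt d) : ℝ :=
  MvPolynomial.eval (fun i => x i) p

/-- The polynomials of degree at most `m` that vanish at `x`. -/
def polySpace {d : ℕ} (m : ℕ) (x : Pt d) : Set (MvPolynomial (Fin d) ℝ) :=
  {p | p.totalDegree ≤ m ∧ polyFun p x = 0}

/-- The weighted least-squares functional
`(1/2) ∑_{y ∈ M} (u(y) - p(y))² Φ(‖x - y‖)`. -/
noncomputable def lsq {d : ℕ} (Φ : ℝ → ℝ) (x : Pt d) (M : Finset (Pt d)) (u : Pt d → ℝ)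
    (p : MvPolynomial (Fin d) ℝ) : ℝ :=
  (1 / 2) * ∑ y ∈ M, (u y - polyFun p y) ^ 2 * Φ ‖x - y‖

/-- `p` is a best weighted least-squares fit to `u` on `M` out of `polySpace m x`. -/
def IsFit {d : ℕ} (m : ℕ) (Φ : ℝ → ℝ) (x : Pt d) (M : Finset (Pt d)) (u : Pt d → ℝ)
    (p : MvPolynomial (Fin d) ℝ) : Prop :=
  p ∈ polySpace m x ∧ ∀ q ∈ polySpace m x, lsq Φ x M u p ≤ lsq Φ x M u q

open Classical in
/-- The GMLS derivative at `x`: for the best fit `p = ∑ b_k p_k` (in any basis `p_k` of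
`polySpace m x`) it is `∑ b_k D^α p_k (x) = D^α p (x)`. The default `0` is only used
when there is no best fit. -/
noncomputable def gmlsDeriv {d : ℕ} (m : ℕ) (Φ : ℝ → ℝ) (x : Pt d) (M : Finset (Pt d))
    (α : Fin d → ℕ) (u : Pt d → ℝ) : ℝ :=
  if h : ∃ p, IsFit m Φ x M u p then partialD α (polyFun h.choose) x else 0

end GMLS

/-!
The cone condition provides a ball of radius `4 m² h` inside `Ω` at distance `O(h)` from `x`.
By Markov's inequality along segments, a polynomial of degree at most `m` is controlled on this
ball by its values at the data points there, where the weight is bounded away from `0`; rescaling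
the ball to the unit ball, `h ^ |α| * |D^α q x|` is bounded by the weighted `ℓ²` norm of the data
of `q`. This makes the fit unique. The fit is the orthogonal projection of the data of `u`, so if
`T` is the Taylor polynomial of `u` at `x`, which vanishes at `x` like `u`, the data of `p - T` are
no larger than those of `u - T`. The latter are `O(h ^ (m + 1))`, since by separation only boundedly
many data points lie in the support of the weight. As `D^α T x = D^α u x` for `|α| ≤ m`, the error
bound follows; for `|α| = m + 1` the approximation is `0` and the bound is trivial.
-/

namespace GMLS

open Metric MvPolynomial

variable {d m : ℕ}

section PolynomialFunctions

theorem contDiff_polyFun (p : MvPolynomial (Fin d) ℝ) {n : WithTop ℕ∞} :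
    ContDiff ℝ n (polyFun p) :=
  contDiffOn_univ.1 ((AnalyticOnNhd.eval_continuousLinearMap'
    (fun i => (EuclideanSpace.proj i : Pt d →L[ℝ] ℝ)) p).contDiffOn uniqueDiffOn_univ)

/-- `polyFun` as a linear map. -/
noncomputable def polyFunLM (d : ℕ) : MvPolynomial (Fin d) ℝ →ₗ[ℝ] Pt d → ℝ where
  toFun := polyFun
  map_add' p q := by ext x; simp [polyFun]
  map_smul' a p := by ext x; simp [polyFun, smul_eval]

@[simp]
theorem polyFunLM_apply (p : MvPolynomial (Fin d) ℝ) : polyFunLM d p = polyFun p := rfl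

/-- The functional `p ↦ D^α p (x)` on polynomials. -/
noncomputable def partialDLM (α : Fin d → ℕ) (x : Pt d) : MvPolynomial (Fin d) ℝ →ₗ[ℝ] ℝ where
  toFun p := partialD α (polyFun p) x
  map_add' p q := by
    rw [← polyFunLM_apply, map_add, polyFunLM_apply, polyFunLM_apply, partialD,
      iteratedFDeriv_add_apply (contDiff_polyFun p).contDiffAt (contDiff_polyFun q).contDiffAt]
    rfl
  map_smul' a p := by
    rw [← polyFunLM_apply, map_smul, polyFunLM_apply, partialD,
      iteratedFDeriv_const_smul_apply (contDiff_polyFun p).contDiffAt]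
    rfl

@[simp]
theorem partialDLM_apply (α : Fin d → ℕ) (x : Pt d) (p : MvPolynomial (Fin d) ℝ) :
    partialDLM α x p = partialD α (polyFun p) x := rfl

theorem continuous_partialD_polyFun (α : Fin d → ℕ) (p : MvPolynomial (Fin d) ℝ) :
    Continuous (partialD α (polyFun p)) :=
  ((contDiff_polyFun p (n := ⊤)).continuous_iteratedFDeriv (by exact_mod_cast le_top)).eval_const _

theorem length_dirs (α : Fin d → ℕ) : (dirs α).length = ∑ i, α i := by
  simp [dirs, List.length_flatMap, List.sum_ofFn, ← List.ofFn_id]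

theorem eq_zero_of_polyFun_eq_zero_on_closedBall {p : MvPolynomial (Fin d) ℝ} {z : Pt d} {s : ℝ}
    (hs : 0 < s) (h : ∀ y ∈ closedBall z s, polyFun p y = 0) : p = 0 := by
  have hnhds : (WithLp.toLp 2 : (Fin d → ℝ) → Pt d) ⁻¹' closedBall z s ∈ nhds (WithLp.ofLp z) :=
    (PiLp.continuous_toLp 2 _).continuousAt (closedBall_mem_nhds _ hs)
  obtain ⟨ε, hε, hsub⟩ := Metric.mem_nhds_iff.1 hnhds
  refine MvPolynomial.funext_set (fun i => ball (z i) ε) (fun i => ?_) fun x hx => ?_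
  · rw [Real.ball_eq_Ioo]
    exact Set.Ioo_infinite (by linarith)
  · rw [← ball_pi _ hε] at hx
    simpa [polyFun] using h _ (hsub hx)

end PolynomialFunctions

section Rescaling

/-- The polynomial `w ↦ p (z + s w)`. -/
noncomputable def rescale (z : Pt d) (s : ℝ) (p : MvPolynomial (Fin d) ℝ) :
    MvPolynomial (Fin d) ℝ :=
  bind₁ (fun i => C (z i) + C s * X i) p

theorem polyFun_rescale (z : Pt d) (s : ℝ) (p : MvPolynomial (Fin d) ℝ) (w : Pt d) :
    polyFun (rescale z s p) w = polyFun p (z + s • w) := by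
  simp only [polyFun, rescale, ← MvPolynomial.coe_aeval_eq_eval, RingHom.coe_coe, aeval_bind₁]
  simp

theorem totalDegree_bind₁_le {σ τ R : Type*} [CommSemiring R] {n : ℕ} {f : σ → MvPolynomial τ R}
    (hf : ∀ i, (f i).totalDegree ≤ n) (p : MvPolynomial σ R) :
    (bind₁ f p).totalDegree ≤ p.totalDegree * n := by
  classical
  conv_lhs => rw [p.as_sum, map_sum]
  refine (totalDegree_finsetSum _ _).trans (Finset.sup_le fun v hv => ?_)
  rw [bind₁_monomial]
  calc (C (coeff v p) * ∏ i ∈ v.support, f i ^ v i).totalDegree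
      ≤ (C (coeff v p)).totalDegree + (∏ i ∈ v.support, f i ^ v i).totalDegree :=
        totalDegree_mul _ _
    _ ≤ 0 + ∑ i ∈ v.support, v i * n := by
        rw [totalDegree_C]
        gcongr
        exact (totalDegree_finsetProd _ _).trans (Finset.sum_le_sum fun i _ =>
          (totalDegree_pow _ _).trans (Nat.mul_le_mul_left _ (hf i)))
    _ ≤ p.totalDegree * n := by
        rw [zero_add, ← Finset.sum_mul]
        exact Nat.mul_le_mul_right _ (le_totalDegree hv)

theorem totalDegree_rescale_le (z : Pt d) (s : ℝ) (p : MvPolynomial (Fin d) ℝ) :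
    (rescale z s p).totalDegree ≤ p.totalDegree := by
  refine (totalDegree_bind₁_le (n := 1) (fun i => ?_) p).trans (mul_one _).le
  refine (totalDegree_add _ _).trans (max_le (by simp) ?_)
  exact (totalDegree_mul _ _).trans (by simp)

theorem partialD_rescale (α : Fin d → ℕ) (z : Pt d) (s : ℝ) (p : MvPolynomial (Fin d) ℝ)
    (w : Pt d) : partialD α (polyFun (rescale z s p)) w =
      s ^ (∑ i, α i) * partialD α (polyFun p) (z + s • w) := by
  have hcomp : polyFun (rescale z s p) =
      (fun y => polyFun p (z + y)) ∘ (s • ContinuousLinearMap.id ℝ (Pt d)) := by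
    ext w
    simp [polyFun_rescale]
  have hsmooth : ContDiff ℝ ⊤ fun y => polyFun p (z + y) :=
    (contDiff_polyFun p).comp (contDiff_const.add contDiff_id)
  rw [partialD, hcomp,
    ContinuousLinearMap.iteratedFDeriv_comp_right _ hsmooth _ (by exact_mod_cast le_top),
    iteratedFDeriv_comp_add_left]
  simp only [ContinuousMultilinearMap.compContinuousLinearMap_apply, _root_.smul_apply,
    ContinuousLinearMap.id_apply]
  rw [ContinuousMultilinearMap.map_smul_univ]
  simp [partialD, length_dirs]

theorem partialD_monomial_zero {α : Fin d → ℕ} {v : Fin d →₀ ℕ} (hv : v.degree ≠ ∑ i, α i)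
    (a : ℝ) : partialD α (polyFun (monomial v a)) 0 = 0 := by
  -- Dilating by `2` multiplies the monomial by `2 ^ v.degree`, its derivative at `0` by `2 ^ |α|`.
  have hdil : polyFun (rescale 0 2 (monomial v a)) =
      polyFun ((2 : ℝ) ^ v.degree • monomial v a) := by
    ext w
    rw [polyFun_rescale]
    simp only [polyFun, smul_eval, eval_monomial, Finsupp.prod, zero_add,
      PiLp.smul_apply, smul_eq_mul, mul_pow, Finset.prod_mul_distrib, Finset.prod_pow_eq_pow_sum,
      Finsupp.degree_apply]
    ring
  have hpow := partialD_rescale α 0 2 (monomial v a) 0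
  rw [hdil, ← partialDLM_apply, map_smul, partialDLM_apply, smul_eq_mul, smul_zero, add_zero]
    at hpow
  refine (mul_eq_mul_right_iff.1 hpow).resolve_left fun h => hv ?_
  exact pow_right_injective₀ two_pos (by norm_num) h

theorem partialD_polyFun_eq_zero {α : Fin d → ℕ} {p : MvPolynomial (Fin d) ℝ}
    (h : p.totalDegree < ∑ i, α i) (x : Pt d) : partialD α (polyFun p) x = 0 := by
  have hzero (q : MvPolynomial (Fin d) ℝ) (hq : q.totalDegree < ∑ i, α i) :
      partialD α (polyFun q) 0 = 0 := by
    rw [← partialDLM_apply, q.as_sum, map_sum]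
    exact Finset.sum_eq_zero fun v hv =>
      partialD_monomial_zero ((le_totalDegree hv).trans_lt hq).ne _
  simpa [partialD_rescale] using
    hzero (rescale x 1 p) ((totalDegree_rescale_le x 1 p).trans_lt h)

end Rescaling

section InverseInequality

theorem exists_norm_le_of_injective {V X Y : Type*} [AddCommGroup V] [Module ℝ V]
    [FiniteDimensional ℝ V] [NormedAddCommGroup X] [NormedSpace ℝ X] [NormedAddCommGroup Y]
    [NormedSpace ℝ Y] (E : V →ₗ[ℝ] X) (F : V →ₗ[ℝ] Y) (hE : Function.Injective E) :
    ∃ C : ℝ, 0 ≤ C ∧ ∀ v, ‖F v‖ ≤ C * ‖E v‖ := by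
  let e := LinearEquiv.ofInjective E hE
  let G : LinearMap.range E →L[ℝ] Y := LinearMap.toContinuousLinearMap (F ∘ₗ e.symm.toLinearMap)
  refine ⟨‖G‖, G.opNorm_nonneg, fun v => ?_⟩
  simpa [G, e, LinearEquiv.ofInjective_apply] using G.le_opNorm (e v)

theorem exists_partialD_bound_unitBall (d m : ℕ) (α : Fin d → ℕ) (R : ℝ) :
    ∃ C : ℝ, 0 ≤ C ∧ ∀ p : MvPolynomial (Fin d) ℝ, p.totalDegree ≤ m → ∀ A : ℝ,
      (∀ w ∈ closedBall (0 : Pt d) 1, |polyFun p w| ≤ A) →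
      ∀ w ∈ closedBall (0 : Pt d) R, |partialD α (polyFun p) w| ≤ C * A := by
  have hcompact (ρ : ℝ) : CompactSpace (closedBall (0 : Pt d) ρ) :=
    isCompact_iff_compactSpace.1 (isCompact_closedBall _ _)
  have := hcompact 1
  have := hcompact R
  let E : restrictTotalDegree (Fin d) ℝ m →ₗ[ℝ] C(closedBall (0 : Pt d) 1, ℝ) :=
    { toFun := fun p => ⟨fun w => polyFun p.1 w,
        (contDiff_polyFun p.1 (n := 0)).continuous.comp continuous_subtype_val⟩
      map_add' := fun p q => by ext w; exact congrFun (map_add (polyFunLM d) p.1 q.1) w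
      map_smul' := fun a p => by ext w; exact congrFun (map_smul (polyFunLM d) a p.1) w }
  let F : restrictTotalDegree (Fin d) ℝ m →ₗ[ℝ] C(closedBall (0 : Pt d) R, ℝ) :=
    { toFun := fun p => ⟨fun w => partialD α (polyFun p.1) w,
        (continuous_partialD_polyFun α p.1).comp continuous_subtype_val⟩
      map_add' := fun p q => by ext w; exact map_add (partialDLM α w.1) p.1 q.1
      map_smul' := fun a p => by ext w; exact map_smul (partialDLM α w.1) a p.1 }
  have hE : Function.Injective E := (injective_iff_map_eq_zero E).2 fun p hp =>
    Subtype.ext <| eq_zero_of_polyFun_eq_zero_on_closedBall (z := 0) one_pos fun y hy =>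
      DFunLike.congr_fun hp ⟨y, hy⟩
  obtain ⟨C, hC0, hC⟩ := exists_norm_le_of_injective E F hE
  refine ⟨C, hC0, fun p hp A hA w hw => ?_⟩
  let p' : restrictTotalDegree (Fin d) ℝ m := ⟨p, (mem_restrictTotalDegree _ _ _).2 hp⟩
  have hA0 : 0 ≤ A := (abs_nonneg _).trans (hA 0 (by simp))
  calc |partialD α (polyFun p) w| = ‖F p' ⟨w, hw⟩‖ := rfl
    _ ≤ ‖F p'‖ := ContinuousMap.norm_coe_le_norm _ _
    _ ≤ C * ‖E p'‖ := hC p'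
    _ ≤ C * A := by
        gcongr
        exact (ContinuousMap.norm_le _ hA0).2 fun w => hA w.1 w.2

theorem exists_partialD_bound (d m : ℕ) (α : Fin d → ℕ) (R : ℝ) :
    ∃ C : ℝ, 0 ≤ C ∧ ∀ p : MvPolynomial (Fin d) ℝ, p.totalDegree ≤ m → ∀ (A s : ℝ) (z : Pt d),
      0 < s → (∀ y ∈ closedBall z s, |polyFun p y| ≤ A) →
      ∀ y ∈ closedBall z (R * s), s ^ (∑ i, α i) * |partialD α (polyFun p) y| ≤ C * A := by
  obtain ⟨C, hC0, hC⟩ := exists_partialD_bound_unitBall d m α R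
  refine ⟨C, hC0, fun p hp A s z hs hA y hy => ?_⟩
  have hvalues (w : Pt d) (hw : w ∈ closedBall 0 1) : |polyFun (rescale z s p) w| ≤ A := by
    rw [polyFun_rescale]
    apply hA
    rw [mem_closedBall_zero_iff] at hw
    rw [mem_closedBall_iff_norm, add_sub_cancel_left, norm_smul, Real.norm_of_nonneg hs.le]
    exact mul_le_of_le_one_right hs.le hw
  have hy' : s⁻¹ • (y - z) ∈ closedBall (0 : Pt d) R := by
    rw [mem_closedBall_iff_norm] at hy
    rwa [mem_closedBall_zero_iff, norm_smul, Real.norm_of_nonneg (inv_nonneg.2 hs.le),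
      inv_mul_le_iff₀ hs, mul_comm]
  have hbound := hC (rescale z s p) ((totalDegree_rescale_le z s p).trans hp) A hvalues _ hy'
  rwa [partialD_rescale, smul_inv_smul₀ hs.ne', add_sub_cancel, abs_mul,
    abs_of_nonneg (by positivity)] at hbound

end InverseInequality

section Norming

theorem abs_derivative_eval_one_le {P : Polynomial ℝ} (hP : P.degree ≤ m) {A : ℝ}
    (hA : ∀ x ∈ Set.Icc (-1 : ℝ) 1, |P.eval x| ≤ A) :
    |P.derivative.eval 1| ≤ m ^ 2 * A := by
  obtain rfl | hA0 := ((abs_nonneg _).trans (hA 0 (by simp))).eq_or_lt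
  · have hzero : P = 0 := Polynomial.eq_zero_of_infinite_isRoot P <|
      (Set.Icc_infinite (by norm_num : (-1 : ℝ) < 1)).mono fun x hx =>
        abs_eq_zero.1 ((hA x hx).antisymm (abs_nonneg _))
    simp [hzero]
  have one_sided (Q : Polynomial ℝ) (hQ : Q.degree ≤ m)
      (hQA : ∀ x ∈ Set.Icc (-1 : ℝ) 1, |Q.eval x| ≤ A) : Q.derivative.eval 1 ≤ m ^ 2 * A := by
    have hcheb := Polynomial.Chebyshev.eval_iterate_derivative_le_of_forall_abs_le_one
      (P := Polynomial.C A⁻¹ * Q) (k := 1) le_rfl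
      ((Polynomial.degree_C_mul (inv_ne_zero hA0.ne')).trans_le hQ) fun x hx => by
        rw [Polynomial.eval_mul, Polynomial.eval_C, abs_mul, abs_of_pos (inv_pos.2 hA0),
          inv_mul_le_iff₀ hA0, mul_one]
        exact hQA x hx
    rw [Function.iterate_one, Polynomial.derivative_C_mul, Polynomial.eval_mul, Polynomial.eval_C,
      Polynomial.Chebyshev.derivative_T_eval_one, inv_mul_le_iff₀ hA0] at hcheb
    rw [mul_comm]
    exact_mod_cast hcheb
  have hneg := one_sided (-P) (by rwa [Polynomial.degree_neg]) fun x hx => by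
    rw [Polynomial.eval_neg, abs_neg]
    exact hA x hx
  rw [Polynomial.derivative_neg, Polynomial.eval_neg] at hneg
  exact abs_le'.2 ⟨one_sided P hP hA, hneg⟩

theorem abs_derivative_eval_left_le {P : Polynomial ℝ} (hP : P.degree ≤ m) {A a b : ℝ}
    (hab : a < b) (hA : ∀ x ∈ Set.Icc a b, |P.eval x| ≤ A) :
    |P.derivative.eval a| ≤ 2 * m ^ 2 / (b - a) * A := by
  let L : Polynomial ℝ :=
    Polynomial.C ((a + b) / 2) - Polynomial.C ((b - a) / 2) * Polynomial.X
  have hL : L.natDegree ≤ 1 := (Polynomial.natDegree_sub_le _ _).trans <|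
    max_le (by simp) ((Polynomial.natDegree_C_mul_le _ _).trans (by simp))
  have hdeg : (P.comp L).degree ≤ m := by
    refine Polynomial.natDegree_le_iff_degree_le.1 (Polynomial.natDegree_comp_le.trans ?_)
    simpa using Nat.mul_le_mul (Polynomial.natDegree_le_iff_degree_le.2 hP) hL
  have hone := abs_derivative_eval_one_le hdeg (A := A) fun x hx => by
    rw [Polynomial.eval_comp]
    apply hA
    simp only [L, Polynomial.eval_sub, Polynomial.eval_C, Polynomial.eval_mul, Polynomial.eval_X]
    constructor <;> nlinarith [hx.1, hx.2]
  have hL1 : L.eval 1 = a := by simp [L]; ring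
  have hL1' : L.derivative.eval 1 = -((b - a) / 2) := by simp [L]
  rw [Polynomial.derivative_comp, Polynomial.eval_mul, Polynomial.eval_comp, hL1, hL1', abs_mul,
    abs_neg, abs_of_pos (by linarith)] at hone
  rw [div_mul_eq_mul_div, le_div_iff₀ (by linarith)]
  linarith

theorem abs_eval_one_sub_eval_zero_le {P : Polynomial ℝ} (hP : P.degree ≤ m) {A T : ℝ}
    (hT : 1 < T) (hA : ∀ x ∈ Set.Icc 0 T, |P.eval x| ≤ A) :
    |P.eval 1 - P.eval 0| ≤ 2 * m ^ 2 / (T - 1) * A := by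
  have hA0 : 0 ≤ A := (abs_nonneg _).trans (hA 0 ⟨le_rfl, by linarith⟩)
  have hderiv (t : ℝ) (ht : t ∈ Set.Icc (0 : ℝ) 1) :
      ‖deriv (fun x => P.eval x) t‖ ≤ 2 * m ^ 2 / (T - 1) * A := by
    have : 0 < T - 1 := by linarith
    rw [Polynomial.deriv, Real.norm_eq_abs]
    calc |P.derivative.eval t| ≤ 2 * m ^ 2 / (T - t) * A :=
          abs_derivative_eval_left_le hP (by linarith [ht.2])
            fun y hy => hA y ⟨ht.1.trans hy.1, hy.2⟩
      _ ≤ 2 * m ^ 2 / (T - 1) * A := by gcongr; exact ht.2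
  simpa using (convex_Icc (0 : ℝ) 1).norm_image_sub_le_of_norm_deriv_le
    (fun t _ => P.differentiableAt) hderiv (Set.left_mem_Icc.2 zero_le_one)
    (Set.right_mem_Icc.2 zero_le_one)

theorem exists_polynomial_on_line {p : MvPolynomial (Fin d) ℝ} (hp : p.totalDegree ≤ m)
    (y v : Pt d) : ∃ P : Polynomial ℝ, P.degree ≤ m ∧ ∀ t, P.eval t = polyFun p (y + t • v) := by
  refine ⟨aeval (fun i => Polynomial.C (y i) + Polynomial.C (v i) * Polynomial.X) p, ?_,
    fun t => ?_⟩
  · refine Polynomial.natDegree_le_iff_degree_le.1 ((aeval_natDegree_le p hp _ (n := 1)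
      fun i => ?_).trans (by simp))
    exact (Polynomial.natDegree_add_le _ _).trans
      (max_le (by simp) ((Polynomial.natDegree_C_mul_le _ _).trans (by simp)))
  · rw [polyFun, ← Polynomial.coe_evalRingHom, MvPolynomial.aeval_def, MvPolynomial.hom_eval₂,
      MvPolynomial.eval, MvPolynomial.coe_eval₂Hom]
    congr 1
    · ext a; simp
    · ext i; simp; ring

theorem abs_polyFun_sub_le_of_segment {p : MvPolynomial (Fin d) ℝ} (hp : p.totalDegree ≤ m)
    {B : Set (Pt d)} (hB : Convex ℝ B) {A T : ℝ} (hT : 1 < T) (hA : ∀ x ∈ B, |polyFun p x| ≤ A)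
    {y w : Pt d} (hy : y ∈ B) (hw : y + T • (w - y) ∈ B) :
    |polyFun p w - polyFun p y| ≤ 2 * m ^ 2 / (T - 1) * A := by
  obtain ⟨P, hPdeg, hP⟩ := exists_polynomial_on_line hp y (w - y)
  have hT0 : 0 < T := by linarith
  have hbound (t : ℝ) (ht : t ∈ Set.Icc 0 T) : |P.eval t| ≤ A := by
    rw [hP]
    apply hA
    have hmem := hB.add_smul_sub_mem hy hw (t := t / T)
      ⟨div_nonneg ht.1 hT0.le, (div_le_one hT0).2 ht.2⟩
    rwa [add_sub_cancel_left, smul_smul, div_mul_cancel₀ _ hT0.ne'] at hmem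
  simpa [hP] using abs_eval_one_sub_eval_zero_le hPdeg hT hbound

theorem exists_mem_closedBall_prolongable {E : Type*} [SeminormedAddCommGroup E] [NormedSpace ℝ E]
    {M : Set E} {y z : E} {h R T : ℝ} (hM : ∀ x ∈ closedBall z R, ∃ w ∈ M, ‖x - w‖ ≤ h)
    (hT : 1 ≤ T) (hTh : T * h ≤ R) (hy : y ∈ closedBall z R) :
    ∃ w ∈ M ∩ closedBall z R, y + T • (w - y) ∈ closedBall z R := by
  -- The contraction by `T⁻¹` towards `y` maps the ball into itself. Choose `w` close to the image
  -- of the center `z`: its preimage `y + T (w - y)` is within `T h ≤ R` of `z`.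
  have hT0 : 0 < T := one_pos.trans_le hT
  have hR : 0 ≤ R := dist_nonneg.trans hy
  have hTinv : T⁻¹ ∈ Set.Icc (0 : ℝ) 1 := ⟨by positivity, inv_le_one_of_one_le₀ hT⟩
  obtain ⟨w, hwM, hw⟩ := hM _
    ((convex_closedBall z R).add_smul_sub_mem hy (mem_closedBall_self hR) hTinv)
  have hend : y + T • (w - y) ∈ closedBall z R := by
    have hrw : y + T • (w - y) - z = T • (w - (y + T⁻¹ • (z - y))) := by
      rw [sub_add_eq_sub_sub, smul_sub T (w - y), smul_inv_smul₀ hT0.ne']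
      abel
    rw [mem_closedBall_iff_norm, hrw, norm_smul, Real.norm_of_nonneg hT0.le, norm_sub_rev]
    exact (by gcongr : _ ≤ T * h).trans hTh
  have hwB := (convex_closedBall z R).add_smul_sub_mem hy hend hTinv
  rw [add_sub_cancel_left, inv_smul_smul₀ hT0.ne', add_sub_cancel] at hwB
  exact ⟨w, ⟨hwM, hwB⟩, hend⟩

theorem abs_polyFun_le_three_mul {p : MvPolynomial (Fin d) ℝ} (hp : p.totalDegree ≤ m)
    (hm : 0 < m) {M : Set (Pt d)} {z : Pt d} {h A : ℝ} (hh : 0 < h)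
    (hM : ∀ y ∈ closedBall z (4 * m ^ 2 * h), ∃ w ∈ M, ‖y - w‖ ≤ h)
    (hA : ∀ w ∈ M ∩ closedBall z (4 * m ^ 2 * h), |polyFun p w| ≤ A) :
    ∀ y ∈ closedBall z (4 * m ^ 2 * h), |polyFun p y| ≤ 3 * A := by
  obtain ⟨y, hy, hmax⟩ := (isCompact_closedBall z (4 * m ^ 2 * h)).exists_isMaxOn
    (nonempty_closedBall.2 (by positivity))
    (contDiff_polyFun p (n := 0)).continuous.abs.continuousOn
  have hm1 : (1 : ℝ) ≤ (m : ℝ) ^ 2 := one_le_pow₀ (by exact_mod_cast hm)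
  obtain ⟨w, hw, hend⟩ := exists_mem_closedBall_prolongable hM (T := 1 + 3 * m ^ 2)
    (by linarith) (by gcongr; linarith) hy
  have hvar : |polyFun p w - polyFun p y| ≤ 2 / 3 * |polyFun p y| := by
    convert abs_polyFun_sub_le_of_segment hp (convex_closedBall z _) (by linarith) hmax hy hend
      using 2
    field_simp
    ring
  have htri : |polyFun p y| - |polyFun p w| ≤ |polyFun p w - polyFun p y| := by
    rw [abs_sub_comm]
    exact abs_sub_abs_le_abs_sub _ _
  exact fun x hx => (hmax hx).trans (by linarith [hA w hw])

end Norming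

section Cone

theorem closedBall_subset_cone {x ξ : Pt d} {θ s R : ℝ} (hξ : ‖ξ‖ = 1) (hs : 0 < s)
    (hθ : 0 < Real.sin θ) (hR : s / Real.sin θ + s ≤ R) :
    closedBall (x + (s / Real.sin θ) • ξ) s ⊆ cone x ξ θ R := by
  intro g hg
  obtain ⟨w, rfl⟩ : ∃ w, g = x + w := ⟨g - x, by abel⟩
  set ρ := s / Real.sin θ with hρ
  have hρ0 : 0 < ρ := by positivity
  have hρξ : ‖ρ • ξ‖ = ρ := by rw [norm_smul, hξ, Real.norm_of_nonneg hρ0.le, mul_one]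
  rw [mem_closedBall_iff_norm, add_sub_add_left_eq_sub] at hg
  obtain rfl | hw := eq_or_ne w 0
  · refine ⟨0, ξ, le_rfl, by linarith, hξ, ?_, by simp⟩
    rw [real_inner_self_eq_norm_sq, hξ, one_pow]
    exact Real.cos_le_one θ
  have hw0 : 0 < ‖w‖ := norm_pos_iff.2 hw
  have hinner : ‖w‖ * Real.cos θ ≤ inner ℝ w ξ := by
    have hsq : ‖w - ρ • ξ‖ ^ 2 ≤ s ^ 2 := by gcongr
    rw [norm_sub_sq_real, hρξ, real_inner_smul_right] at hsq
    have hs_sq : s ^ 2 = ρ ^ 2 * (1 - Real.cos θ ^ 2) := by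
      rw [← Real.sin_sq, ← mul_pow, hρ, div_mul_cancel₀ _ hθ.ne']
    have hmul : 2 * ρ * (‖w‖ * Real.cos θ) ≤ 2 * ρ * inner ℝ w ξ := by
      nlinarith [sq_nonneg (‖w‖ - ρ * Real.cos θ)]
    exact le_of_mul_le_mul_left hmul (by positivity)
  refine ⟨‖w‖, ‖w‖⁻¹ • w, hw0.le, by linarith [norm_le_norm_sub_add w (ρ • ξ)],
    norm_smul_inv_norm hw, ?_, by rw [smul_inv_smul₀ hw0.ne']⟩
  rwa [real_inner_smul_left, le_inv_mul_iff₀ hw0]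

end Cone

section Symmetry

variable {𝕜 E F : Type*} [RCLike 𝕜] [NormedAddCommGroup E] [NormedSpace 𝕜 E]
  [NormedAddCommGroup F] [NormedSpace 𝕜 F] {f : E → F}

theorem iteratedFDeriv_get_eq_of_perm {L L' : List E} (h : L.Perm L') {x : E}
    (hf : ContDiffAt 𝕜 L.length f x) :
    iteratedFDeriv 𝕜 L.length f x L.get = iteratedFDeriv 𝕜 L'.length f x L'.get := by
  induction h generalizing x with
  | nil => rfl
  | @cons v L L' hL ih =>
    have hdiff (n : ℕ) (hn : n = L.length) : DifferentiableAt 𝕜 (iteratedFDeriv 𝕜 n f) x :=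
      (hf.iteratedFDeriv_right (m := 1) (by simp [hn, add_comm])).differentiableAt one_ne_zero
    have hev : (fun y => iteratedFDeriv 𝕜 L.length f y L.get) =ᶠ[nhds x]
        fun y => iteratedFDeriv 𝕜 L'.length f y L'.get := by
      filter_upwards [hf.eventually (by simp)] with y hy
      exact ih (hy.of_le (by simp))
    have hleft := (hdiff _ rfl).iteratedFDeriv_succ_apply_left' (m := (v :: L).get)
    have hright := (hdiff _ hL.length_eq.symm).iteratedFDeriv_succ_apply_left'
      (m := (v :: L').get)
    exact hleft.trans ((congrArg (fun A : E →L[𝕜] F => A v) hev.fderiv_eq).trans hright.symm)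
  | swap v w L =>
    have hsymm : IsSymmSndFDerivAt 𝕜 (iteratedFDeriv 𝕜 L.length f) x :=
      (hf.iteratedFDeriv_right (m := 2)
        (by exact_mod_cast (by simp only [List.length_cons]; lia :
          2 + L.length ≤ (w :: v :: L).length))).isSymmSndFDerivAt
        (by simp)
    have hsnd (a b : E) : iteratedFDeriv 𝕜 (a :: b :: L).length f x (a :: b :: L).get =
        fderiv 𝕜 (fderiv 𝕜 (iteratedFDeriv 𝕜 L.length f)) x a b L.get := by
      have hcomp := LinearIsometryEquiv.comp_fderiv (𝕜 := 𝕜)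
        (continuousMultilinearCurryLeftEquiv 𝕜 (fun _ : Fin (L.length + 1) => E) F).symm
        (f := fderiv 𝕜 (iteratedFDeriv 𝕜 L.length f)) (x := x)
      exact congrArg (fun A : E →L[𝕜] E [×(L.length + 1)]→L[𝕜] F => A a (b :: L).get) hcomp
    rw [hsnd, hsnd, hsymm]
  | trans h _ ih ih' => exact (ih hf).trans (ih' (h.length_eq ▸ hf))

theorem iteratedFDeriv_eq_of_perm {k n : ℕ} {v : Fin k → E} {w : Fin n → E}
    (h : (List.ofFn v).Perm (List.ofFn w)) {x : E} (hf : ContDiffAt 𝕜 n f x) :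
    iteratedFDeriv 𝕜 k f x v = iteratedFDeriv 𝕜 n f x w := by
  have hget (j : ℕ) (L : List E) (hL : L.length = j) : iteratedFDeriv 𝕜 L.length f x L.get =
      iteratedFDeriv 𝕜 j f x fun i => L.get (i.cast hL.symm) := by
    subst hL
    rfl
  have hperm := iteratedFDeriv_get_eq_of_perm h (f := f) (x := x) (𝕜 := 𝕜)
    (by rwa [h.length_eq, List.length_ofFn])
  rw [hget k _ List.length_ofFn, hget n _ List.length_ofFn] at hperm
  simpa using hperm

end Symmetry

section PartialDerivatives

theorem perm_dirs_count (L : List (Fin d)) : L.Perm (dirs fun i => L.count i) := by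
  refine List.perm_iff_count.2 fun i => ?_
  simp [dirs, List.count_flatMap, Function.comp_def, List.count_replicate, ← List.ofFn_id,
    List.sum_ofFn]

theorem exists_iteratedFDeriv_eq_partialD {n : ℕ} {f : Pt d → ℝ} {x : Pt d}
    (hf : ContDiffAt ℝ n f x) (σ : Fin n → Fin d) : ∃ α : Fin d → ℕ, ∑ i, α i = n ∧
      iteratedFDeriv ℝ n f x (fun j => EuclideanSpace.single (σ j) 1) = partialD α f x := by
  have hperm := (perm_dirs_count (List.ofFn σ)).symm
  refine ⟨_, by rw [← length_dirs, hperm.length_eq, List.length_ofFn], ?_⟩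
  refine (iteratedFDeriv_eq_of_perm ?_ hf).symm
  rw [← List.ofFn_get (dirs _)] at hperm
  simpa only [List.map_ofFn, Function.comp_def] using
    hperm.map fun i => EuclideanSpace.single i (1 : ℝ)

theorem apply_diag_eq_sum {ι G : Type*} [Fintype ι] [DecidableEq ι] [AddCommGroup G] [Module ℝ G]
    {k : ℕ} (A : MultilinearMap ℝ (fun _ : Fin k => EuclideanSpace ℝ ι) G)
    (w : EuclideanSpace ℝ ι) : A (fun _ => w) =
      ∑ σ : Fin k → ι, (∏ j, w (σ j)) • A fun j => EuclideanSpace.single (σ j) 1 := by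
  conv_lhs => rw [← (EuclideanSpace.basisFun ι ℝ).sum_repr w]
  rw [A.map_sum]
  simp only [A.map_smul_univ, EuclideanSpace.basisFun_repr, EuclideanSpace.basisFun_apply]

theorem bddAbove_abs_partialDWithin {k : ℕ} {S : Set (Pt d)} {u : Pt d → ℝ} (hS : IsCompact S)
    (hSu : UniqueDiffOn ℝ S) (hu : ContDiffOn ℝ k u S) :
    BddAbove (Set.range fun z : {β : Fin d → ℕ // ∑ i, β i ≤ k} × S =>
      |partialDWithin z.1.1 u S z.2|) := by
  have hfinite : Finite {β : Fin d → ℕ // ∑ i, β i ≤ k} :=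
    (Set.finite_Iic fun _ : Fin d => k).subset fun β hβ i =>
      (Finset.single_le_sum (fun _ _ => Nat.zero_le _) (Finset.mem_univ i)).trans hβ
  have hbound (β : {β : Fin d → ℕ // ∑ i, β i ≤ k}) :
      ∃ B, ∀ z ∈ S, |partialDWithin β.1 u S z| ≤ B := by
    have hcont : ContinuousOn (iteratedFDerivWithin ℝ (dirs β.1).length u S) S :=
      hu.continuousOn_iteratedFDerivWithin (by rw [length_dirs]; exact_mod_cast β.2) hSu
    exact hS.exists_bound_of_continuousOn (hcont.eval_const _)
  choose B hB using hbound
  obtain ⟨K, hK⟩ := (Set.finite_range B).bddAbove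
  exact ⟨K, Set.forall_mem_range.2 fun ⟨β, z⟩ =>
    (hB β z z.2).trans (hK (Set.mem_range_self β))⟩

theorem cNorm_nonneg (k : ℕ) (S : Set (Pt d)) (u : Pt d → ℝ) : 0 ≤ cNorm k S u :=
  Real.iSup_nonneg fun _ => abs_nonneg _

theorem abs_partialD_le_cNorm {k : ℕ} {x y : Pt d} {δ : ℝ} {u : Pt d → ℝ}
    (hu : ContDiffOn ℝ k u (closedBall x δ)) {α : Fin d → ℕ} (hα : ∑ i, α i ≤ k)
    (hy : y ∈ ball x δ) : |partialD α u y| ≤ cNorm k (closedBall x δ) u := by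
  have hunique : UniqueDiffOn ℝ (closedBall x δ) := uniqueDiffOn_convex (convex_closedBall x δ)
    ⟨y, ball_subset_interior_closedBall hy⟩
  have hwithin : partialD α u y = partialDWithin α u (closedBall x δ) y := by
    rw [partialD, partialDWithin, ← iteratedFDerivWithin_univ, iteratedFDerivWithin_congr_set
      (Filter.eventuallyEq_univ.2 (closedBall_mem_nhds_of_mem hy)).symm]
  rw [hwithin]
  exact le_ciSup (bddAbove_abs_partialDWithin (isCompact_closedBall x δ) hunique hu)
    (⟨⟨α, hα⟩, ⟨y, ball_subset_closedBall hy⟩⟩ :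
      {β : Fin d → ℕ // ∑ i, β i ≤ k} × closedBall x δ)

end PartialDerivatives

section Taylor

variable {u : Pt d → ℝ} {x : Pt d}

/-- The Taylor polynomial of degree `m` of `u` at `x`, as a sum over tuples of directions `σ` rather
than over multi-indices. -/
noncomputable def taylorPoly (m : ℕ) (u : Pt d → ℝ) (x : Pt d) : MvPolynomial (Fin d) ℝ :=
  ∑ k ∈ Finset.range (m + 1), ∑ σ : Fin k → Fin d,
    C ((k.factorial : ℝ)⁻¹ *
        iteratedFDeriv ℝ k u x fun j => EuclideanSpace.single (σ j) (1 : ℝ)) *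
      ∏ j, (X (σ j) - C (x (σ j)))

theorem totalDegree_taylorPoly_le (m : ℕ) (u : Pt d → ℝ) (x : Pt d) :
    (taylorPoly m u x).totalDegree ≤ m := by
  refine (totalDegree_finsetSum _ _).trans (Finset.sup_le fun k hk => ?_)
  refine (totalDegree_finsetSum _ _).trans (Finset.sup_le fun σ _ => ?_)
  refine (totalDegree_mul _ _).trans ?_
  rw [totalDegree_C, zero_add]
  calc (∏ j, (X (σ j) - C (x (σ j))) : MvPolynomial (Fin d) ℝ).totalDegree
      ≤ ∑ j, (X (σ j) - C (x (σ j)) : MvPolynomial (Fin d) ℝ).totalDegree :=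
        totalDegree_finsetProd _ _
    _ ≤ ∑ _j : Fin k, 1 := Finset.sum_le_sum fun j _ =>
        (totalDegree_sub_C_le _ _).trans (totalDegree_X _).le
    _ ≤ m := by simpa using Nat.lt_succ_iff.1 (Finset.mem_range.1 hk)

theorem polyFun_taylorPoly (m : ℕ) (u : Pt d → ℝ) (x y : Pt d) :
    polyFun (taylorPoly m u x) y = ∑ k ∈ Finset.range (m + 1),
      (k.factorial : ℝ)⁻¹ • iteratedFDeriv ℝ k u x fun _ => y - x := by
  rw [polyFun, taylorPoly, map_sum]
  refine Finset.sum_congr rfl fun k _ => ?_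
  rw [← ContinuousMultilinearMap.coe_coe, apply_diag_eq_sum, map_sum, Finset.smul_sum]
  refine Finset.sum_congr rfl fun σ _ => ?_
  simp only [map_mul, map_prod, map_sub, eval_X, eval_C, PiLp.sub_apply, smul_eq_mul,
    ContinuousMultilinearMap.coe_coe]
  ring

theorem polyFun_taylorPoly_self (m : ℕ) (u : Pt d → ℝ) (x : Pt d) :
    polyFun (taylorPoly m u x) x = u x := by
  rw [polyFun_taylorPoly, Finset.sum_range_succ', Finset.sum_eq_zero fun k _ => by
    rw [sub_self, ContinuousMultilinearMap.map_coord_zero _ 0 rfl, smul_zero]]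
  simp

theorem iteratedFDeriv_taylorPoly {n : ℕ} (hn : n ≤ m) (hu : ContDiffAt ℝ n u x)
    (v : Fin n → Pt d) :
    iteratedFDeriv ℝ n (polyFun (taylorPoly m u x)) x v = iteratedFDeriv ℝ n u x v := by
  let q : FormalMultilinearSeries ℝ (Pt d) ℝ := fun k =>
    if k < m + 1 then (k.factorial : ℝ)⁻¹ • iteratedFDeriv ℝ k u x else 0
  have hq : HasFiniteFPowerSeriesOnBall (polyFun (taylorPoly m u x)) q x (m + 1) ⊤ := by
    refine HasFiniteFPowerSeriesOnBall.mk' (fun k hk => if_neg hk.not_gt) (by simp) fun y _ => ?_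
    rw [polyFun_taylorPoly, add_sub_cancel_left]
    refine Finset.sum_congr rfl fun k hk => ?_
    simp only [q, if_pos (Finset.mem_range.1 hk), _root_.smul_apply]
  rw [hq.toHasFPowerSeriesOnBall.iteratedFDeriv_eq_sum_of_completeSpace]
  have hterm (σ : Equiv.Perm (Fin n)) : q n (fun i => v (σ i)) =
      (n.factorial : ℝ)⁻¹ * iteratedFDeriv ℝ n u x v := by
    rw [← iteratedFDeriv_eq_of_perm (σ.ofFn_comp_perm v) hu]
    simp only [q, if_pos (Nat.lt_succ_of_le hn)]
    rfl
  simp only [hterm, Finset.sum_const, Finset.card_univ, Fintype.card_perm, Fintype.card_fin,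
    nsmul_eq_mul]
  rw [mul_inv_cancel_left₀ (by exact_mod_cast n.factorial_ne_zero)]

theorem partialD_taylorPoly (hu : ContDiffAt ℝ m u x) {α : Fin d → ℕ} (hα : ∑ i, α i ≤ m) :
    partialD α (polyFun (taylorPoly m u x)) x = partialD α u x := by
  rw [← length_dirs] at hα
  exact iteratedFDeriv_taylorPoly hα (hu.of_le (by exact_mod_cast hα)) _

theorem abs_iteratedFDeriv_diag_le {n : ℕ} {y : Pt d} {δ : ℝ}
    (hu : ContDiffOn ℝ n u (closedBall x δ)) (hy : y ∈ ball x δ) (w : Pt d) :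
    |iteratedFDeriv ℝ n u y fun _ => w| ≤
      (d : ℝ) ^ n * ‖w‖ ^ n * cNorm n (closedBall x δ) u := by
  rw [← ContinuousMultilinearMap.coe_coe, apply_diag_eq_sum]
  calc _ ≤ ∑ _σ : Fin n → Fin d, ‖w‖ ^ n * cNorm n (closedBall x δ) u := by
        refine (Finset.abs_sum_le_sum_abs _ _).trans (Finset.sum_le_sum fun σ _ => ?_)
        rw [smul_eq_mul, abs_mul, Finset.abs_prod]
        gcongr
        · calc ∏ j, |w (σ j)| ≤ ∏ _j : Fin n, ‖w‖ :=
                Finset.prod_le_prod (fun _ _ => abs_nonneg _) fun j _ => PiLp.norm_apply_le w (σ j)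
            _ = ‖w‖ ^ n := by simp
        · obtain ⟨α, hα, hασ⟩ := exists_iteratedFDeriv_eq_partialD
            (hu.contDiffAt (closedBall_mem_nhds_of_mem hy)) σ
          rw [ContinuousMultilinearMap.coe_coe, hασ]
          exact abs_partialD_le_cNorm hu hα.le hy
    _ = (d : ℝ) ^ n * ‖w‖ ^ n * cNorm n (closedBall x δ) u := by simp [mul_assoc]

theorem abs_sub_taylorPoly_le_of_mem_ball {y : Pt d} {δ : ℝ}
    (hu : ContDiffOn ℝ (m + 1 : ℕ) u (closedBall x δ)) (hy : y ∈ ball x δ) :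
    |u y - polyFun (taylorPoly m u x) y| ≤
      (d : ℝ) ^ (m + 1) * ‖y - x‖ ^ (m + 1) * cNorm (m + 1) (closedBall x δ) u := by
  have hsegment (t : ℝ) (ht : t ∈ Set.Icc (0 : ℝ) 1) : x + t • (y - x) ∈ ball x δ :=
    (convex_ball x δ).add_smul_sub_mem (mem_ball_self (pos_of_mem_ball hy)) hy ht
  have htaylor := map_add_eq_sum_add_integral_iteratedFDeriv (f := u) (x := x) (y := y - x) (n := m)
    fun t ht => by exact_mod_cast hu.contDiffAt (closedBall_mem_nhds_of_mem (hsegment t ht))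
  rw [← polyFun_taylorPoly, add_sub_cancel] at htaylor
  rw [htaylor, add_sub_cancel_left, smul_eq_mul, abs_mul]
  have hintegral := intervalIntegral.norm_integral_le_of_norm_le_const (a := (0 : ℝ)) (b := 1)
    (f := fun t => (1 - t) ^ m • iteratedFDeriv ℝ (m + 1) u (x + t • (y - x)) fun _ => y - x)
    (C := (d : ℝ) ^ (m + 1) * ‖y - x‖ ^ (m + 1) * cNorm (m + 1) (closedBall x δ) u) fun t ht => by
      rw [Set.uIoc_of_le zero_le_one] at ht
      have hpow : |(1 - t) ^ m| ≤ 1 := by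
        rw [abs_of_nonneg (pow_nonneg (by linarith [ht.2]) _)]
        exact pow_le_one₀ (by linarith [ht.2]) (by linarith [ht.1])
      rw [norm_smul, Real.norm_eq_abs, Real.norm_eq_abs]
      exact (mul_le_of_le_one_left (abs_nonneg _) hpow).trans
        (abs_iteratedFDeriv_diag_le hu (hsegment t ⟨ht.1.le, ht.2⟩) _)
  rw [sub_zero, abs_one, mul_one, Real.norm_eq_abs] at hintegral
  have hfactorial : |((m.factorial : ℝ))⁻¹| ≤ 1 := by
    rw [abs_of_nonneg (by positivity)]
    exact inv_le_one_of_one_le₀ (by exact_mod_cast m.factorial_pos)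
  exact (mul_le_of_le_one_left (abs_nonneg _) hfactorial).trans hintegral

theorem abs_sub_taylorPoly_le {y : Pt d} {δ : ℝ} (hδ : δ ≠ 0)
    (hu : ContDiffOn ℝ (m + 1 : ℕ) u (closedBall x δ)) (hy : y ∈ closedBall x δ) :
    |u y - polyFun (taylorPoly m u x) y| ≤
      (d : ℝ) ^ (m + 1) * ‖y - x‖ ^ (m + 1) * cNorm (m + 1) (closedBall x δ) u := by
  have hcont := hu.continuousOn.sub
    (contDiff_polyFun (taylorPoly m u x) (n := 0)).continuous.continuousOn
  rw [← closure_ball x hδ] at hy hcont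
  exact le_on_closure (fun z hz => abs_sub_taylorPoly_le_of_mem_ball hu hz) hcont.abs
    (by fun_prop) hy

end Taylor

section PointSets

theorem exists_card_le_of_separated (E : Type*) [NormedAddCommGroup E] [NormedSpace ℝ E]
    [ProperSpace E] {η : ℝ} (hη : 0 < η) :
    ∃ N : ℕ, ∀ (x : E) (δ : ℝ) (M : Finset E), 0 < δ → (M : Set E) ⊆ closedBall x δ →
      (M : Set E).Pairwise (fun y z => η * δ ≤ ‖y - z‖) → M.card ≤ N := by
  obtain ⟨t, -, htfin, ht⟩ := (isCompact_closedBall (0 : E) 1).finite_cover_balls (half_pos hη)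
  refine ⟨htfin.toFinset.card, fun x δ M hδ hM hsep => ?_⟩
  have hcenter (y : E) (hy : y ∈ M) : ∃ a ∈ t, δ⁻¹ • (y - x) ∈ ball a (η / 2) := by
    have hunit : δ⁻¹ • (y - x) ∈ closedBall (0 : E) 1 := by
      rw [mem_closedBall_zero_iff, norm_smul, Real.norm_of_nonneg (inv_nonneg.2 hδ.le),
        inv_mul_le_iff₀ hδ, mul_one]
      exact mem_closedBall_iff_norm.1 (hM hy)
    simpa using ht hunit
  choose! a hat ha using hcenter
  refine Finset.card_le_card_of_injOn a (fun y hy => by simpa using hat y hy)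
    fun y hy z hz hyz => by_contra fun hne => (hsep hy hz hne).not_gt ?_
  have hclose : ‖δ⁻¹ • (y - x) - δ⁻¹ • (z - x)‖ < η := by
    rw [← dist_eq_norm, ← add_halves η]
    exact (dist_triangle_right _ _ (a y)).trans_lt
      (add_lt_add (ha y hy) (by rw [hyz]; exact ha z hz))
  rwa [← smul_sub, sub_sub_sub_cancel_right, norm_smul, Real.norm_of_nonneg (inv_nonneg.2 hδ.le),
    inv_mul_lt_iff₀ hδ, mul_comm] at hclose

variable {M : Finset (Pt d)} {Ω : Set (Pt d)}

theorem two_mul_sepDist_le {y z : Pt d} (hy : y ∈ M) (hz : z ∈ M) (hyz : y ≠ z) :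
    2 * sepDist M ≤ ‖y - z‖ := by
  have hinf : sInf {s : ℝ | ∃ x ∈ M, ∃ y ∈ M, x ≠ y ∧ s = ‖x - y‖} ≤ ‖y - z‖ :=
    csInf_le ⟨0, by rintro _ ⟨a, -, b, -, -, rfl⟩; exact norm_nonneg _⟩ ⟨y, hy, z, hz, hyz, rfl⟩
  rw [sepDist]
  linarith

theorem infDist_le_fillDist (hΩ : Bornology.IsBounded Ω) {y : Pt d} (hy : y ∈ Ω) :
    infDist y M ≤ fillDist M Ω :=
  le_csSup ((lipschitz_infDist_pt _).isBounded_image hΩ).bddAbove ⟨y, hy, rfl⟩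

theorem exists_norm_sub_le_fillDist (hΩ : Bornology.IsBounded Ω) (hM : M.Nonempty) {y : Pt d}
    (hy : y ∈ Ω) : ∃ w ∈ M, ‖y - w‖ ≤ fillDist M Ω := by
  obtain ⟨w, hw, hdist⟩ := M.finite_toSet.isCompact.exists_infDist_eq_dist hM y
  exact ⟨w, hw, by rw [← dist_eq_norm, ← hdist]; exact infDist_le_fillDist hΩ hy⟩

theorem fillDist_pos (hΩ : Bornology.IsBounded Ω) (hM : M.Nonempty) {x : Pt d} (hx : x ∈ Ω)
    (hxM : x ∉ M) : 0 < fillDist M Ω :=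
  ((M.finite_toSet.isClosed.notMem_iff_infDist_pos hM).1 hxM).trans_le (infDist_le_fillDist hΩ hx)

theorem notMem_midpoints (Ωh : Finset (Pt d)) (x : Pt d) (ε : ℝ) : x ∉ midpoints Ωh x ε := by
  simp only [midpoints, Finset.mem_image, Finset.mem_filter, not_exists, not_and]
  exact fun y hy hmid => hy.2.1 ((midpoint_eq_left_iff ℝ).1 hmid).symm

end PointSets

section LeastSquares

variable {Φ : ℝ → ℝ} {x : Pt d} {M : Finset (Pt d)} {u : Pt d → ℝ}

/-- The values of a function on `M`, scaled by the square roots of the weights, so that the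
Euclidean norm of this vector is the norm of weighted least squares. -/
noncomputable def weightedEval (Φ : ℝ → ℝ) (x : Pt d) (M : Finset (Pt d)) :
    (Pt d → ℝ) →ₗ[ℝ] EuclideanSpace ℝ M where
  toFun f := WithLp.toLp 2 fun y => √(Φ ‖x - y‖) * f y
  map_add' f g := by ext y; simp [mul_add]
  map_smul' a f := by ext y; simp [mul_left_comm]

theorem norm_sq_weightedEval (hΦ : ∀ s, 0 ≤ s → 0 ≤ Φ s) (f : Pt d → ℝ) :
    ‖weightedEval Φ x M f‖ ^ 2 = ∑ y ∈ M, f y ^ 2 * Φ ‖x - y‖ := by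
  rw [EuclideanSpace.norm_sq_eq, ← Finset.sum_coe_sort M]
  refine Finset.sum_congr rfl fun y _ => ?_
  rw [Real.norm_eq_abs, sq_abs, weightedEval, LinearMap.coe_mk, AddHom.coe_mk, mul_pow,
    Real.sq_sqrt (hΦ _ (norm_nonneg _)), mul_comm]

theorem abs_le_norm_weightedEval_div {κ : ℝ} (hκ : 0 < κ) {y : Pt d} (hy : y ∈ M)
    (hΦy : κ ≤ Φ ‖x - y‖) (f : Pt d → ℝ) : |f y| ≤ ‖weightedEval Φ x M f‖ / √κ := by
  rw [le_div_iff₀ (Real.sqrt_pos.2 hκ)]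
  calc |f y| * √κ ≤ |f y| * √(Φ ‖x - y‖) := by gcongr
    _ = ‖weightedEval Φ x M f ⟨y, hy⟩‖ := by
        simp [weightedEval, abs_of_nonneg, mul_comm]
    _ ≤ ‖weightedEval Φ x M f‖ := PiLp.norm_apply_le _ _

theorem lsq_eq_norm_sq (hΦ : ∀ s, 0 ≤ s → 0 ≤ Φ s) (p : MvPolynomial (Fin d) ℝ) :
    lsq Φ x M u p = 1 / 2 * ‖weightedEval Φ x M u - weightedEval Φ x M (polyFun p)‖ ^ 2 := by
  rw [← map_sub, norm_sq_weightedEval hΦ]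
  rfl

/-- `polySpace m x` as a subspace. -/
noncomputable def polySubmodule (m : ℕ) (x : Pt d) : Submodule ℝ (MvPolynomial (Fin d) ℝ) where
  carrier := polySpace m x
  zero_mem' := ⟨by simp, congrFun (map_zero (polyFunLM d)) x⟩
  add_mem' := fun {p q} hp hq => ⟨(totalDegree_add p q).trans (max_le hp.1 hq.1),
    (congrFun (map_add (polyFunLM d) p q) x).trans (by simp [hp.2, hq.2])⟩
  smul_mem' := fun a p hp => ⟨(totalDegree_smul_le a p).trans hp.1,
    (congrFun (map_smul (polyFunLM d) a p) x).trans (by simp [hp.2])⟩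

/-- The image of `polySpace m x` under weighted evaluation on `M`. -/
noncomputable def fitSpace (m : ℕ) (Φ : ℝ → ℝ) (x : Pt d) (M : Finset (Pt d)) :
    Submodule ℝ (EuclideanSpace ℝ M) :=
  (polySubmodule m x).map (weightedEval Φ x M ∘ₗ polyFunLM d)

theorem weightedEval_mem_fitSpace {p : MvPolynomial (Fin d) ℝ} (hp : p ∈ polySpace m x) :
    weightedEval Φ x M (polyFun p) ∈ fitSpace m Φ x M :=
  Submodule.mem_map_of_mem (f := weightedEval Φ x M ∘ₗ polyFunLM d) (p := polySubmodule m x) hp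

theorem isFit_iff_eq_starProjection (hΦ : ∀ s, 0 ≤ s → 0 ≤ Φ s) {p : MvPolynomial (Fin d) ℝ} :
    IsFit m Φ x M u p ↔ p ∈ polySpace m x ∧ weightedEval Φ x M (polyFun p) =
      (fitSpace m Φ x M).starProjection (weightedEval Φ x M u) := by
  refine and_congr_right fun hp => ?_
  have hle (q : MvPolynomial (Fin d) ℝ) : lsq Φ x M u p ≤ lsq Φ x M u q ↔
      ‖weightedEval Φ x M u - weightedEval Φ x M (polyFun p)‖ ≤
        ‖weightedEval Φ x M u - weightedEval Φ x M (polyFun q)‖ := by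
    rw [lsq_eq_norm_sq hΦ, lsq_eq_norm_sq hΦ, mul_le_mul_iff_right₀ one_half_pos,
      sq_le_sq₀ (norm_nonneg _) (norm_nonneg _)]
  have hbdd : BddBelow (Set.range fun w : fitSpace m Φ x M => ‖weightedEval Φ x M u - w‖) :=
    ⟨0, Set.forall_mem_range.2 fun _ => norm_nonneg _⟩
  simp only [hle]
  constructor
  · intro hmin
    refine ((Submodule.eq_starProjection_of_mem_of_inner_eq_zero (weightedEval_mem_fitSpace hp)
      ((Submodule.norm_eq_iInf_iff_real_inner_eq_zero _ (weightedEval_mem_fitSpace hp)).1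
        (le_antisymm ?_ ?_)))).symm
    · exact le_ciInf fun ⟨_, q, hq, hqw⟩ => hqw ▸ hmin q hq
    · exact ciInf_le hbdd ⟨_, weightedEval_mem_fitSpace hp⟩
  · intro hproj q hq
    rw [hproj, Submodule.starProjection_minimal]
    exact ciInf_le hbdd ⟨_, weightedEval_mem_fitSpace hq⟩

theorem exists_isFit (m : ℕ) (x : Pt d) (M : Finset (Pt d)) (u : Pt d → ℝ)
    (hΦ : ∀ s, 0 ≤ s → 0 ≤ Φ s) : ∃ p, IsFit m Φ x M u p := by
  obtain ⟨p, hp, hproj⟩ := Submodule.mem_map.1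
    ((fitSpace m Φ x M).starProjection_apply_mem (weightedEval Φ x M u))
  exact ⟨p, (isFit_iff_eq_starProjection hΦ).2 ⟨hp, hproj⟩⟩

theorem existsUnique_isFit (hΦ : ∀ s, 0 ≤ s → 0 ≤ Φ s)
    (hinj : ∀ p : MvPolynomial (Fin d) ℝ, p.totalDegree ≤ m →
      weightedEval Φ x M (polyFun p) = 0 → p = 0) : ∃! p, IsFit m Φ x M u p := by
  refine existsUnique_of_exists_of_unique (exists_isFit m x M u hΦ) fun p q hp hq => ?_
  rw [isFit_iff_eq_starProjection hΦ] at hp hq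
  refine sub_eq_zero.1 (hinj _ ((totalDegree_sub p q).trans (max_le hp.1.1 hq.1.1)) ?_)
  rw [← polyFunLM_apply, map_sub, map_sub, polyFunLM_apply, polyFunLM_apply, hp.2, hq.2, sub_self]

theorem IsFit.norm_weightedEval_sub_le (hΦ : ∀ s, 0 ≤ s → 0 ≤ Φ s)
    {p q : MvPolynomial (Fin d) ℝ} (hp : IsFit m Φ x M u p) (hq : q ∈ polySpace m x) :
    ‖weightedEval Φ x M (polyFun (p - q))‖ ≤ ‖weightedEval Φ x M (u - polyFun q)‖ := by
  rw [← polyFunLM_apply, map_sub, map_sub, map_sub, polyFunLM_apply, polyFunLM_apply,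
    ((isFit_iff_eq_starProjection hΦ).1 hp).2, ← Submodule.starProjection_eq_self_iff.2
      (weightedEval_mem_fitSpace hq), ← map_sub, Submodule.starProjection_eq_self_iff.2
      (weightedEval_mem_fitSpace hq)]
  exact Submodule.norm_starProjection_apply_le _ _

theorem gmlsDeriv_eq (h : ∃! p, IsFit m Φ x M u p) {p : MvPolynomial (Fin d) ℝ}
    (hp : IsFit m Φ x M u p) (α : Fin d → ℕ) :
    gmlsDeriv m Φ x M α u = partialD α (polyFun p) x := by
  rw [gmlsDeriv, dif_pos h.exists, h.unique h.exists.choose_spec hp]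

end LeastSquares

section ErrorEstimate

theorem coneConst_pos (hm : 0 < m) {θ : ℝ} (hθ : 0 < Real.sin θ) : 0 < coneConst m θ := by
  rw [coneConst]
  positivity

theorem InteriorConeCondition.exists_closedBall_subset {Ω : Set (Pt d)} {θ r h : ℝ} {x : Pt d}
    (hΩ : InteriorConeCondition Ω θ r) (hx : x ∈ Ω) (hm : 0 < m) (hθ : 0 < Real.sin θ)
    (hh : 0 < h) (hhr : h ≤ r / coneConst m θ) :
    ∃ z, closedBall z (4 * m ^ 2 * h) ⊆ Ω ∧
      x ∈ closedBall z ((Real.sin θ)⁻¹ * (4 * m ^ 2 * h)) ∧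
      closedBall z (4 * m ^ 2 * h) ⊆ closedBall x (3 / 8 * coneConst m θ * h) := by
  obtain ⟨ξ, hξ, hcone⟩ := hΩ x hx
  have hCC := coneConst_pos hm hθ
  have hs : 0 < 4 * (m : ℝ) ^ 2 * h := by positivity
  have hsum : 4 * (m : ℝ) ^ 2 * h / Real.sin θ + 4 * m ^ 2 * h ≤ 3 / 8 * coneConst m θ * h := by
    have hdiff : 3 / 8 * coneConst m θ * h - (4 * m ^ 2 * h / Real.sin θ + 4 * m ^ 2 * h) =
        2 * m ^ 2 * h * (1 + Real.sin θ) * (1 - Real.sin θ) / Real.sin θ ^ 2 := by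
      rw [coneConst]
      field_simp
      ring
    have hsin : 0 ≤ 1 - Real.sin θ := sub_nonneg.2 (Real.sin_le_one θ)
    exact sub_nonneg.1 (hdiff ▸ by positivity)
  have hdist : ‖(4 * m ^ 2 * h / Real.sin θ) • ξ‖ = 4 * m ^ 2 * h / Real.sin θ := by
    rw [norm_smul, hξ, mul_one, Real.norm_of_nonneg (by positivity)]
  refine ⟨x + (4 * m ^ 2 * h / Real.sin θ) • ξ, ?_, ?_, closedBall_subset_closedBall' ?_⟩
  · refine (closedBall_subset_cone hξ hs hθ (hsum.trans ?_)).trans hcone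
    rw [le_div_iff₀ hCC] at hhr
    nlinarith [mul_pos hCC hh]
  · rw [mem_closedBall_iff_norm, sub_add_cancel_left, norm_neg, hdist, div_eq_inv_mul]
  · rwa [dist_self_add_left, hdist, add_comm]

theorem exists_closedBall_abs_polyFun_le {Ω : Set (Pt d)} {θ r h κ : ℝ} {x : Pt d}
    {M : Finset (Pt d)} {Φ : ℝ → ℝ} (hΩ : InteriorConeCondition Ω θ r) (hx : x ∈ Ω) (hm : 0 < m)
    (hθ : 0 < Real.sin θ) (hh : 0 < h) (hhr : h ≤ r / coneConst m θ)
    (hM : ∀ y ∈ Ω, ∃ w ∈ M, ‖y - w‖ ≤ h) (hκ : 0 < κ)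
    (hΦ : ∀ s, 0 ≤ s → s ≤ 3 / 8 * coneConst m θ * h → κ ≤ Φ s) :
    ∃ z, x ∈ closedBall z ((Real.sin θ)⁻¹ * (4 * m ^ 2 * h)) ∧
      ∀ q : MvPolynomial (Fin d) ℝ, q.totalDegree ≤ m → ∀ y ∈ closedBall z (4 * m ^ 2 * h),
        |polyFun q y| ≤ 3 * (‖weightedEval Φ x M (polyFun q)‖ / √κ) := by
  obtain ⟨z, hzΩ, hxz, hzx⟩ := hΩ.exists_closedBall_subset hx hm hθ hh hhr
  refine ⟨z, hxz, fun q hq => abs_polyFun_le_three_mul (M := M) hq hm hh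
    (fun y hy => hM y (hzΩ hy)) fun w hw => abs_le_norm_weightedEval_div hκ hw.1 ?_ _⟩
  exact hΦ _ (norm_nonneg _) (mem_closedBall_iff_norm'.1 (hzx hw.2))

theorem exists_stability {φ : ℝ → ℝ} (hφ : IsWeightProfile φ) (hm : 0 < m) {θ : ℝ}
    (hθ : 0 < Real.sin θ) (α : Fin d → ℕ) :
    ∃ S : ℝ, 0 ≤ S ∧ ∀ (Ω : Set (Pt d)) (r h : ℝ) (x : Pt d) (M : Finset (Pt d)),
      InteriorConeCondition Ω θ r → x ∈ Ω → 0 < h → h ≤ r / coneConst m θ →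
      (∀ y ∈ Ω, ∃ w ∈ M, ‖y - w‖ ≤ h) → ∀ q : MvPolynomial (Fin d) ℝ, q.totalDegree ≤ m →
      (weightedEval (fun s => φ (s / (2 * coneConst m θ * h))) x M (polyFun q) = 0 → q = 0) ∧
        h ^ (∑ i, α i) * |partialD α (polyFun q) x| ≤
          S * ‖weightedEval (fun s => φ (s / (2 * coneConst m θ * h))) x M (polyFun q)‖ := by
  obtain ⟨κ, hκ, hφκ⟩ := hφ.pos (3 / 16) (by norm_num)
  obtain ⟨C, hC, hderiv⟩ := exists_partialD_bound d m α (Real.sin θ)⁻¹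
  have hCC := coneConst_pos hm hθ
  refine ⟨C * (3 / √κ), by positivity, fun Ω r h x M hΩ hx hh hhr hM q hq => ?_⟩
  obtain ⟨z, hxz, hz⟩ := exists_closedBall_abs_polyFun_le
    (Φ := fun s => φ (s / (2 * coneConst m θ * h))) hΩ hx hm hθ hh hhr hM hκ fun s hs hs' =>
      hφκ _ (by positivity) ((div_le_iff₀ (by positivity)).2 (hs'.trans_eq (by ring)))
  have hs : 0 < 4 * (m : ℝ) ^ 2 * h := by positivity
  have hhs : h ≤ 4 * m ^ 2 * h := by
    have hm1 : (1 : ℝ) ≤ (m : ℝ) ^ 2 := one_le_pow₀ (by exact_mod_cast hm)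
    exact le_mul_of_one_le_left hh.le (by linarith)
  constructor
  · intro h0
    refine eq_zero_of_polyFun_eq_zero_on_closedBall (z := z) hs fun y hy => abs_nonpos_iff.1 ?_
    simpa [h0] using hz q hq y hy
  · calc h ^ (∑ i, α i) * |partialD α (polyFun q) x|
        ≤ (4 * m ^ 2 * h) ^ (∑ i, α i) * |partialD α (polyFun q) x| := by gcongr
      _ ≤ _ := hderiv q hq _ _ z hs (hz q hq) x hxz
      _ = _ := by ring

theorem exists_norm_weightedEval_le (d : ℕ) {φ : ℝ → ℝ} (hφ : IsWeightProfile φ) {η : ℝ}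
    (hη : 0 < η) :
    ∃ L : ℝ, 0 ≤ L ∧ ∀ (δ : ℝ) (x : Pt d) (M : Finset (Pt d)) (f : Pt d → ℝ) (E : ℝ),
      0 < δ → η * δ ≤ 2 * sepDist M → (∀ y ∈ closedBall x δ, |f y| ≤ E) →
      ‖weightedEval (fun s => φ (s / δ)) x M f‖ ≤ L * E := by
  classical
  obtain ⟨K, hK⟩ := hφ.bounded
  obtain ⟨N, hN⟩ := exists_card_le_of_separated (Pt d) hη
  have hK0 : 0 ≤ K := (hφ.nonneg 0 le_rfl).trans (hK 0 le_rfl)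
  refine ⟨√(N * K), Real.sqrt_nonneg _, fun δ x M f E hδ hsep hE => ?_⟩
  have hE0 : 0 ≤ E := (abs_nonneg _).trans (hE x (mem_closedBall_self hδ.le))
  have hcard : (M.filter (· ∈ closedBall x δ)).card ≤ N :=
    hN x δ _ hδ (fun y hy => (Finset.mem_filter.1 hy).2) fun y hy z hz hyz =>
      hsep.trans (two_mul_sepDist_le (Finset.mem_filter.1 hy).1 (Finset.mem_filter.1 hz).1 hyz)
  refine (sq_le_sq₀ (norm_nonneg _) (by positivity)).1 ?_
  rw [norm_sq_weightedEval fun s hs => hφ.nonneg _ (by positivity), mul_pow,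
    Real.sq_sqrt (by positivity)]
  calc ∑ y ∈ M, f y ^ 2 * φ (‖x - y‖ / δ)
      = ∑ y ∈ M with y ∈ closedBall x δ, f y ^ 2 * φ (‖x - y‖ / δ) := by
        refine (Finset.sum_filter_of_ne fun y _ hne => ?_).symm
        by_contra hy
        rw [mem_closedBall_iff_norm', not_le] at hy
        exact hne (by rw [hφ.support _ ((one_lt_div hδ).2 hy), mul_zero])
    _ ≤ (M.filter (· ∈ closedBall x δ)).card • (E ^ 2 * K) := by
        refine Finset.sum_le_card_nsmul _ _ _ fun y hy => ?_
        exact mul_le_mul (sq_le_sq.2 ((hE y (Finset.mem_filter.1 hy).2).trans (le_abs_self E)))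
          (hK _ (by positivity)) (hφ.nonneg _ (by positivity)) (sq_nonneg E)
    _ ≤ N * K * E ^ 2 := by
        rw [nsmul_eq_mul, mul_comm (E ^ 2), ← mul_assoc]
        gcongr

theorem IsFit.abs_partialD_sub_le {Φ : ℝ → ℝ} {x : Pt d} {M : Finset (Pt d)} {u : Pt d → ℝ}
    {p : MvPolynomial (Fin d) ℝ} {α : Fin d → ℕ} {a δ S L : ℝ} (hΦ : ∀ s, 0 ≤ s → 0 ≤ Φ s)
    (hp : IsFit m Φ x M u p) (hα : ∑ i, α i ≤ m) (hδ : 0 < δ)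
    (hu : ContDiffOn ℝ (m + 1 : ℕ) u (closedBall x δ)) (hux : u x = 0) (hS : 0 ≤ S)
    (hstab : ∀ q : MvPolynomial (Fin d) ℝ, q.totalDegree ≤ m →
      a * |partialD α (polyFun q) x| ≤ S * ‖weightedEval Φ x M (polyFun q)‖)
    (hcons : ∀ (f : Pt d → ℝ) (E : ℝ), (∀ y ∈ closedBall x δ, |f y| ≤ E) →
      ‖weightedEval Φ x M f‖ ≤ L * E) :
    a * |partialD α (polyFun p) x - partialD α u x| ≤
      S * (L * (d ^ (m + 1) * δ ^ (m + 1) * cNorm (m + 1) (closedBall x δ) u)) := by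
  have hT : taylorPoly m u x ∈ polySpace m x :=
    ⟨totalDegree_taylorPoly_le m u x, by rw [polyFun_taylorPoly_self, hux]⟩
  have hux' : ContDiffAt ℝ m u x :=
    (hu.contDiffAt (closedBall_mem_nhds x hδ)).of_le (by exact_mod_cast Nat.le_succ m)
  have hremainder (y : Pt d) (hy : y ∈ closedBall x δ) : |(u - polyFun (taylorPoly m u x)) y| ≤
      d ^ (m + 1) * δ ^ (m + 1) * cNorm (m + 1) (closedBall x δ) u := by
    refine (abs_sub_taylorPoly_le hδ.ne' hu hy).trans ?_
    have hyx := mem_closedBall_iff_norm.1 hy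
    have hnorm := cNorm_nonneg (m + 1) (closedBall x δ) u
    gcongr
  calc a * |partialD α (polyFun p) x - partialD α u x|
      = a * |partialD α (polyFun (p - taylorPoly m u x)) x| := by
        rw [← partialDLM_apply _ _ (p - _), map_sub, partialDLM_apply, partialDLM_apply,
          partialD_taylorPoly hux' hα]
    _ ≤ S * ‖weightedEval Φ x M (polyFun (p - taylorPoly m u x))‖ :=
        hstab _ ((totalDegree_sub _ _).trans (max_le hp.1.1 hT.1))
    _ ≤ S * ‖weightedEval Φ x M (u - polyFun (taylorPoly m u x))‖ := by
        gcongr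
        exact hp.norm_weightedEval_sub_le hΦ hT
    _ ≤ _ := by
        gcongr
        exact hcons _ _ hremainder

theorem IsFit.abs_partialD_sub_le_pow {Φ : ℝ → ℝ} {x : Pt d} {M : Finset (Pt d)} {u : Pt d → ℝ}
    {p : MvPolynomial (Fin d) ℝ} {α : Fin d → ℕ} {b h S L : ℝ} (hΦ : ∀ s, 0 ≤ s → 0 ≤ Φ s)
    (hp : IsFit m Φ x M u p) (hα : ∑ i, α i ≤ m + 1) (hb : 0 < b) (hh : 0 < h)
    (hu : ContDiffOn ℝ (m + 1 : ℕ) u (closedBall x (b * h))) (hux : u x = 0) (hS : 0 ≤ S)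
    (hstab : ∀ q : MvPolynomial (Fin d) ℝ, q.totalDegree ≤ m →
      h ^ (∑ i, α i) * |partialD α (polyFun q) x| ≤ S * ‖weightedEval Φ x M (polyFun q)‖)
    (hcons : ∀ (f : Pt d → ℝ) (E : ℝ), (∀ y ∈ closedBall x (b * h), |f y| ≤ E) →
      ‖weightedEval Φ x M f‖ ≤ L * E) :
    |partialD α (polyFun p) x - partialD α u x| ≤
      max (S * (L * (d ^ (m + 1) * b ^ (m + 1)))) 1 * h ^ (m + 1 - ∑ i, α i) *
        cNorm (m + 1) (closedBall x (b * h)) u := by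
  have hδ : 0 < b * h := mul_pos hb hh
  have hnorm := cNorm_nonneg (m + 1) (closedBall x (b * h)) u
  obtain hle | hlt := le_or_gt (∑ i, α i) m
  · refine le_of_mul_le_mul_left ?_ (pow_pos hh (∑ i, α i))
    calc h ^ (∑ i, α i) * |partialD α (polyFun p) x - partialD α u x|
        ≤ S * (L * (d ^ (m + 1) * (b * h) ^ (m + 1) * cNorm (m + 1) (closedBall x (b * h)) u)) :=
          hp.abs_partialD_sub_le hΦ hle hδ hu hux hS hstab hcons
      _ = h ^ (∑ i, α i) * (S * (L * (d ^ (m + 1) * b ^ (m + 1))) * h ^ (m + 1 - ∑ i, α i) *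
            cNorm (m + 1) (closedBall x (b * h)) u) := by
          rw [mul_pow, ← pow_mul_pow_sub h hα]
          ring
      _ ≤ _ := by
          gcongr
          exact le_max_left _ _
  · rw [partialD_polyFun_eq_zero (hp.1.1.trans_lt hlt), zero_sub, abs_neg,
      Nat.sub_eq_zero_of_le hlt, pow_zero, mul_one]
    exact (abs_partialD_le_cNorm hu hα (mem_ball_self hδ)).trans
      (le_mul_of_one_le_left hnorm (le_max_right _ 1))

end ErrorEstimate
end GMLS

theorem lemma3p3_general (d m : ℕ) (hm : 0 < m) (θ c : ℝ) (hθ : 0 < Real.sin θ) (hc : 0 < c)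
    (φ : ℝ → ℝ) (hφ : GMLS.IsWeightProfile φ) (α : Fin d → ℕ) (hα : ∑ i, α i ≤ m + 1) :
    ∃ C : ℝ, 0 < C ∧
      ∀ (Ω : Set (GMLS.Pt d)) (r : ℝ) (x : GMLS.Pt d) (M : Finset (GMLS.Pt d)) (h δ : ℝ)
        (Φ : ℝ → ℝ) (u : GMLS.Pt d → ℝ),
        GMLS.InteriorConeCondition Ω θ r → x ∈ Ω →
        0 < h → (∀ y ∈ Ω, ∃ w ∈ M, ‖y - w‖ ≤ h) → h ≤ c * GMLS.sepDist M →
        h ≤ r / GMLS.coneConst m θ →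
        δ = 2 * GMLS.coneConst m θ * h → Φ = (fun s => φ (s / δ)) →
        ContDiffOn ℝ ((m + 1 : ℕ) : WithTop ℕ∞) u (Metric.closedBall x δ) → u x = 0 →
        (∃! p, GMLS.IsFit m Φ x M u p) ∧
          |GMLS.gmlsDeriv m Φ x M α u - GMLS.partialD α u x| ≤
            C * h ^ (m + 1 - ∑ i, α i) * GMLS.cNorm (m + 1) (Metric.closedBall x δ) u := by
  open GMLS in
  have hCC := coneConst_pos hm hθ
  obtain ⟨S, hS, hstable⟩ := exists_stability hφ hm hθ α
  obtain ⟨L, -, hcons⟩ := exists_norm_weightedEval_le d hφ (η := (c * coneConst m θ)⁻¹)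
    (by positivity)
  refine ⟨max (S * (L * (d ^ (m + 1) * (2 * coneConst m θ) ^ (m + 1)))) 1, by positivity, ?_⟩
  rintro Ω r x M h δ Φ u hΩ hx hh hM hsep hhr rfl rfl hu hux
  have hδ : 0 < 2 * coneConst m θ * h := by positivity
  have hΦ (s : ℝ) (hs : 0 ≤ s) : 0 ≤ φ (s / (2 * coneConst m θ * h)) :=
    hφ.nonneg _ (by positivity)
  have hηδ : (c * coneConst m θ)⁻¹ * (2 * coneConst m θ * h) ≤ 2 * sepDist M := by
    field_simp
    linarith
  have hstab := hstable Ω r h x M hΩ hx hh hhr hM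
  have hunique := existsUnique_isFit (u := u) hΦ fun q hq => (hstab q hq).1
  obtain ⟨p, hp⟩ := hunique.exists
  refine ⟨hunique, ?_⟩
  rw [gmlsDeriv_eq hunique hp]
  exact hp.abs_partialD_sub_le_pow hΦ hα (by positivity) hh hu hux hS
    (fun q hq => (hstab q hq).2) fun f E => hcons _ x M f E hδ hηδ

theorem lemma3p3 (d m : ℕ) (hm : 0 < m) (θ r c : ℝ) (hθ : 0 < θ) (hθ' : θ < Real.pi / 2)
    (hr : 0 < r) (hc : 0 < c) (φ : ℝ → ℝ) (hφ : GMLS.IsWeightProfile φ)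
    (α : Fin d → ℕ) (hα : ∑ i, α i ≤ m + 1) :
    ∃ C : ℝ, 0 < C ∧
      ∀ (Ω : Set (GMLS.Pt d)) (Ωh : Finset (GMLS.Pt d)) (x : GMLS.Pt d) (ε : ℝ)
        (M : Finset (GMLS.Pt d)) (h δ : ℝ) (Φ : ℝ → ℝ) (u : GMLS.Pt d → ℝ),
        IsCompact Ω → GMLS.InteriorConeCondition Ω θ r →
        0 < ε → x ∈ Ωh → x ∈ Ω →
        M = GMLS.midpoints Ωh x ε → M.Nonempty → (M : Set (GMLS.Pt d)) ⊆ Ω →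
        h = GMLS.fillDist M Ω → GMLS.QuasiUniform c M Ω → h ≤ r / GMLS.coneConst m θ →
        δ = 2 * GMLS.coneConst m θ * h → Φ = (fun s => φ (s / δ)) →
        ContDiffOn ℝ ((m + 1 : ℕ) : WithTop ℕ∞) u (Metric.closedBall x δ) → u x = 0 →
        (∃! p, GMLS.IsFit m Φ x M u p) ∧
          |GMLS.gmlsDeriv m Φ x M α u - GMLS.partialD α u x| ≤
            C * h ^ (m + 1 - ∑ i, α i) * GMLS.cNorm (m + 1) (Metric.closedBall x δ) u := by
  obtain ⟨C, hC, hlemma⟩ := lemma3p3_general d m hm θ c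
    (Real.sin_pos_of_pos_of_lt_pi hθ (by linarith [Real.pi_pos])) hc φ hφ α hα
  refine ⟨C, hC, ?_⟩
  rintro Ω Ωh x ε M h δ Φ u hΩ hcone - - hx rfl hM - rfl hqu
  exact hlemma Ω r x _ _ δ Φ u hcone hx
    (GMLS.fillDist_pos hΩ.isBounded hM hx (GMLS.notMem_midpoints Ωh x ε))
    (fun y hy => GMLS.exists_norm_sub_le_fillDist hΩ.isBounded hM hy) hqu.2
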